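/- Let $I,J\subseteq\mathbb R$ be open intervals, $t_0\in J$, and let $r:I\to\mathbb R^3$ be a smooth curve parametrized by arclength with $r''(s)\neq 0$ for every $s\in I$. Let $T=r'$, $N=T'/\|T'\|$, $B=T\times N$ be its Frenet frame, and let $\kappa=\|T'\|$ and $\tau=\langle N',B\rangle$ be its curvature and torsion, so that $T'=\kappa N$, $N'=-\kappa T+\tau B$, $B'=-\tau N$. Let $x:I\times J\to\mathbb R^3$, $(s,t)\mapsto x(s,t)$, be a smooth regular parametrized surface (that is, $x_s$ and $x_t$ are everywhere linearly independent). Then $x$ is a minimal surface (its mean curvature vanishes everywhere) in isothermal parameters (that is, $\langle x_s,x_s\rangle=\langle x_t,x_t\rangle$ and $\langle x_s,x_t\rangle=0$ on $I\times J$) which passes the curve $r$ along $t=t_0$ (that is, $x(s,t_0)=r(s)$ for all $s\in I$), if and only if there exist smooth functions $u,v,w:I\times J\to\mathbb R$ such that $$x(s,t)=r(s)+u(s,t)T(s)+v(s,t)N(s)+w(s,t)B(s)\qquad\text{on } I\times J,$$ $$u(s,t_0)=v(s,t_0)=w(s,t_0)=0\qquad\text{for all } s\in I,$$ and, on $I\times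 J$, $$(1+u_s-\kappa v)^2+(v_s+\kappa u-\tau w)^2+(w_s+\tau v)^2=u_t^2+v_t^2+w_t^2,$$ $$(1+u_s-\kappa v)u_t+(v_s+\kappa u-\tau w)v_t+(w_s+\tau v)w_t=0,$$ $$(1+u_s-\kappa v)_s-\kappa(v_s+\kappa u-\tau w)+u_{tt}=0,$$ $$(v_s+\kappa u-\tau w)_s+\kappa(1+u_s-\kappa v)-\tau(w_s+\tau v)+v_{tt}=0,$$ $$(w_s+\tau v)_s+\tau(v_s+\kappa u-\tau w)+w_{tt}=0.$$ -/

import Mathlib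

open scoped ContDiff

noncomputable section

namespace FrenetSurface

/-- Euclidean three-space. -/
abbrev E3 : Type := EuclideanSpace ℝ (Fin 3)

/-- The vector product of Euclidean three-space. -/
def cross (a b : E3) : E3 := WithLp.toLp 2 (crossProduct a.ofLp b.ofLp)

/-! Partial derivatives of a function of two real variables `(s, t)`. -/

section Partial

variable {F : Type*} [NormedAddCommGroup F] [NormedSpace ℝ F]

/-- The partial derivative with respect to the first variable `s`. -/
def dS (f : ℝ → ℝ → F) (s t : ℝ) : F := deriv (fun s' => f s' t) s

/-- The partial derivative with respect to the second variable `t`. -/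
def dT (f : ℝ → ℝ → F) (s t : ℝ) : F := deriv (fun t' => f s t') t

/-- `f` is jointly smooth in `(s, t)` on the rectangle `I × J`. -/
def SmoothOn (f : ℝ → ℝ → F) (I J : Set ℝ) : Prop :=
  ContDiffOn ℝ ∞ (fun p : ℝ × ℝ => f p.1 p.2) (I ×ˢ J)

end Partial

/-! The Frenet frame, the curvature and the torsion of a unit speed curve. -/

/-- The unit tangent `T = r'`. -/
def T (r : ℝ → E3) (s : ℝ) : E3 := deriv r s

/-- The curvature `κ = ‖T'‖`. -/
def κ (r : ℝ → E3) (s : ℝ) : ℝ := ‖deriv (T r) s‖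

/-- The unit normal `N = T' / ‖T'‖`. -/
def N (r : ℝ → E3) (s : ℝ) : E3 := ‖deriv (T r) s‖⁻¹ • deriv (T r) s

/-- The binormal `B = T × N`. -/
def B (r : ℝ → E3) (s : ℝ) : E3 := cross (T r s) (N r s)

/-- The torsion, with the sign convention `N' = -κ T + τ B`, so `τ = ⟨N', B⟩`. -/
def τ (r : ℝ → E3) (s : ℝ) : ℝ := inner ℝ (deriv (N r) s) (B r s)

/-- An arclength parametrized smooth curve on `I` with nowhere vanishing second derivative,
so that its Frenet frame is defined at every parameter. -/
structure IsFrenetCurve (r : ℝ → E3) (I : Set ℝ) : Prop where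
  smooth : ContDiffOn ℝ ∞ r I
  unit_speed : ∀ s ∈ I, ‖deriv r s‖ = 1
  second_ne_zero : ∀ s ∈ I, deriv (deriv r) s ≠ 0

/-! Parametrized surfaces, fundamental forms and mean curvature. -/

/-- The unit normal `n = x_s × x_t / ‖x_s × x_t‖`. -/
def normal (x : ℝ → ℝ → E3) (s t : ℝ) : E3 :=
  ‖cross (dS x s t) (dT x s t)‖⁻¹ • cross (dS x s t) (dT x s t)

/-- First fundamental form, `E = ⟨x_s, x_s⟩`. -/
def fundE (x : ℝ → ℝ → E3) (s t : ℝ) : ℝ := inner ℝ (dS x s t) (dS x s t)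

/-- First fundamental form, `F = ⟨x_s, x_t⟩`. -/
def fundF (x : ℝ → ℝ → E3) (s t : ℝ) : ℝ := inner ℝ (dS x s t) (dT x s t)

/-- First fundamental form, `G = ⟨x_t, x_t⟩`. -/
def fundG (x : ℝ → ℝ → E3) (s t : ℝ) : ℝ := inner ℝ (dT x s t) (dT x s t)

/-- Second fundamental form, `e = ⟨n, x_ss⟩`. -/
def funde (x : ℝ → ℝ → E3) (s t : ℝ) : ℝ := inner ℝ (normal x s t) (dS (dS x) s t)

/-- Second fundamental form, `f = ⟨n, x_st⟩`. -/
def fundf (x : ℝ → ℝ → E3) (s t : ℝ) : ℝ := inner ℝ (normal x s t) (dT (dS x) s t)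

/-- Second fundamental form, `g = ⟨n, x_tt⟩`. -/
def fundg (x : ℝ → ℝ → E3) (s t : ℝ) : ℝ := inner ℝ (normal x s t) (dT (dT x) s t)

/-- The mean curvature `H = (E g - 2 F f + G e) / (2 (E G - F²))`. -/
def meanCurvature (x : ℝ → ℝ → E3) (s t : ℝ) : ℝ :=
  (fundE x s t * fundg x s t - 2 * fundF x s t * fundf x s t + fundG x s t * funde x s t) /
    (2 * (fundE x s t * fundG x s t - fundF x s t ^ 2))

/-- `x` is a smooth regular parametrized surface on `I × J`. -/
structure IsRegularSurface (x : ℝ → ℝ → E3) (I J : Set ℝ) : Prop where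
  smooth : SmoothOn x I J
  regular : ∀ s ∈ I, ∀ t ∈ J, LinearIndependent ℝ ![dS x s t, dT x s t]

/-- `x` is an isothermal parametrization: `⟨x_s, x_s⟩ = ⟨x_t, x_t⟩` and `⟨x_s, x_t⟩ = 0`. -/
def IsIsothermal (x : ℝ → ℝ → E3) (I J : Set ℝ) : Prop :=
  ∀ s ∈ I, ∀ t ∈ J,
    (inner ℝ (dS x s t) (dS x s t) : ℝ) = inner ℝ (dT x s t) (dT x s t) ∧
      (inner ℝ (dS x s t) (dT x s t) : ℝ) = 0

/-- `x` is a minimal surface: regular, with mean curvature vanishing everywhere. -/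
def IsMinimalSurface (x : ℝ → ℝ → E3) (I J : Set ℝ) : Prop :=
  IsRegularSurface x I J ∧ ∀ s ∈ I, ∀ t ∈ J, meanCurvature x s t = 0

/-- The surface `x` passes the curve `r` along the parameter line `t = t₀`. -/
def PassesCurve (x : ℝ → ℝ → E3) (r : ℝ → E3) (I : Set ℝ) (t₀ : ℝ) : Prop :=
  ∀ s ∈ I, x s t₀ = r s

/-- On `I × J` the surface `x` has the form `x = r + u T + v N + w B`. -/
def HasFrenetForm (x : ℝ → ℝ → E3) (r : ℝ → E3) (u v w : ℝ → ℝ → ℝ) (I J : Set ℝ) : Prop :=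
  ∀ s ∈ I, ∀ t ∈ J, x s t = r s + u s t • T r s + v s t • N r s + w s t • B r s

end FrenetSurface

end

open FrenetSurface

/-!
The position vector of a surface in isothermal parameters satisfies `⟨Δx, n⟩ = 2 E H`, where
`Δx = x_ss + x_tt`. Differentiating `⟨x_s, x_s⟩ = ⟨x_t, x_t⟩` and `⟨x_s, x_t⟩ = 0` shows that
`Δx` is orthogonal to `x_s` and `x_t`, so minimality is equivalent to `Δx = 0`
(`IsIsothermal.isMinimalSurface_iff`).

Since the Frenet frame is orthonormal, `x - r = u T + v N + w B` with
`u, v, w` the components of `x - r`, and these vanish at `t = t₀` exactly when `x(s, t₀) = r(s)`.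
The Frenet equations give the derivative of a vector field along `r` in terms of its frame
coordinates (`IsFrenetCurve.hasDerivAt_frameVec`). Used once for `x_s` and once more for `x_ss`,
this writes `x_s`, `x_t` and `Δx` in the frame; the two isothermal conditions and the three
components of `Δx = 0` are then the five equations
(`HasFrenetForm.isothermal_harmonic_iff`).
-/

/-! ### Partial derivatives of smooth functions of two variables -/

namespace FrenetSurface

section Calculus

variable {F : Type*} [NormedAddCommGroup F] [NormedSpace ℝ F]
  {f g : ℝ → ℝ → F} {I J : Set ℝ} {s t : ℝ}

theorem dS_congr (hI : IsOpen I) (h : ∀ s ∈ I, ∀ t ∈ J, f s t = g s t)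
    (hs : s ∈ I) (ht : t ∈ J) : dS f s t = dS g s t :=
  Filter.EventuallyEq.deriv_eq <| by
    filter_upwards [hI.mem_nhds hs] with s' hs' using h s' hs' t ht

theorem dT_congr (hJ : IsOpen J) (h : ∀ s ∈ I, ∀ t ∈ J, f s t = g s t)
    (hs : s ∈ I) (ht : t ∈ J) : dT f s t = dT g s t :=
  Filter.EventuallyEq.deriv_eq <| by
    filter_upwards [hJ.mem_nhds ht] with t' ht' using h s hs t' ht'

namespace SmoothOn

theorem contDiffAt (hf : SmoothOn f I J) (hI : IsOpen I) (hJ : IsOpen J) (hs : s ∈ I)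
    (ht : t ∈ J) : ContDiffAt ℝ ∞ (fun p : ℝ × ℝ => f p.1 p.2) (s, t) :=
  ContDiffOn.contDiffAt hf ((hI.prod hJ).mem_nhds ⟨hs, ht⟩)

theorem hasDerivAt_fst (hf : SmoothOn f I J) (hI : IsOpen I) (hJ : IsOpen J) (hs : s ∈ I)
    (ht : t ∈ J) :
    HasDerivAt (fun s' => f s' t) (fderiv ℝ (fun p : ℝ × ℝ => f p.1 p.2) (s, t) (1, 0)) s :=
  HasFDerivAt.comp_hasDerivAt (f := fun s' : ℝ => (s', t)) s
    ((hf.contDiffAt hI hJ hs ht).differentiableAt (by simp)).hasFDerivAt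
    ((hasDerivAt_id s).prodMk (hasDerivAt_const s t))

theorem hasDerivAt_snd (hf : SmoothOn f I J) (hI : IsOpen I) (hJ : IsOpen J) (hs : s ∈ I)
    (ht : t ∈ J) :
    HasDerivAt (fun t' => f s t') (fderiv ℝ (fun p : ℝ × ℝ => f p.1 p.2) (s, t) (0, 1)) t :=
  HasFDerivAt.comp_hasDerivAt (f := fun t' : ℝ => (s, t')) t
    ((hf.contDiffAt hI hJ hs ht).differentiableAt (by simp)).hasFDerivAt
    ((hasDerivAt_const t s).prodMk (hasDerivAt_id t))

theorem hasDerivAt_dS (hf : SmoothOn f I J) (hI : IsOpen I) (hJ : IsOpen J) (hs : s ∈ I)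
    (ht : t ∈ J) : HasDerivAt (fun s' => f s' t) (dS f s t) s :=
  (hf.hasDerivAt_fst hI hJ hs ht).differentiableAt.hasDerivAt

theorem hasDerivAt_dT (hf : SmoothOn f I J) (hI : IsOpen I) (hJ : IsOpen J) (hs : s ∈ I)
    (ht : t ∈ J) : HasDerivAt (fun t' => f s t') (dT f s t) t :=
  (hf.hasDerivAt_snd hI hJ hs ht).differentiableAt.hasDerivAt

theorem dS (hf : SmoothOn f I J) (hI : IsOpen I) (hJ : IsOpen J) : SmoothOn (dS f) I J := by
  have h : ContDiffOn ℝ ∞ (fderiv ℝ (fun p : ℝ × ℝ => f p.1 p.2)) (I ×ˢ J) :=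
    ContDiffOn.fderiv_of_isOpen hf (hI.prod hJ) (by simp)
  exact (h.clm_apply (contDiffOn_const (c := ((1, 0) : ℝ × ℝ)))).congr
    fun p hp => (hf.hasDerivAt_fst hI hJ hp.1 hp.2).deriv

theorem dT (hf : SmoothOn f I J) (hI : IsOpen I) (hJ : IsOpen J) : SmoothOn (dT f) I J := by
  have h : ContDiffOn ℝ ∞ (fderiv ℝ (fun p : ℝ × ℝ => f p.1 p.2)) (I ×ˢ J) :=
    ContDiffOn.fderiv_of_isOpen hf (hI.prod hJ) (by simp)
  exact (h.clm_apply (contDiffOn_const (c := ((0, 1) : ℝ × ℝ)))).congr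
    fun p hp => (hf.hasDerivAt_snd hI hJ hp.1 hp.2).deriv

/-- Schwarz's theorem: the mixed partial derivatives agree. -/
theorem dT_dS_eq_dS_dT (hf : SmoothOn f I J) (hI : IsOpen I) (hJ : IsOpen J) (hs : s ∈ I)
    (ht : t ∈ J) :
    FrenetSurface.dT (FrenetSurface.dS f) s t = FrenetSurface.dS (FrenetSurface.dT f) s t := by
  have hd : HasFDerivAt (fderiv ℝ (fun p : ℝ × ℝ => f p.1 p.2)) _ (s, t) :=
    (((hf.contDiffAt hI hJ hs ht).fderiv_right (m := 1) (by norm_cast)).differentiableAt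
      (by simp)).hasFDerivAt
  have hsymm : IsSymmSndFDerivAt ℝ (fun p : ℝ × ℝ => f p.1 p.2) (s, t) :=
    (hf.contDiffAt hI hJ hs ht).isSymmSndFDerivAt (by simp; norm_cast)
  have h₁ := (HasFDerivAt.comp_hasDerivAt (f := fun t' : ℝ => (s, t')) t hd
    ((hasDerivAt_const t s).prodMk (hasDerivAt_id t))).clm_apply
    (hasDerivAt_const t ((1, 0) : ℝ × ℝ))
  have h₂ := (HasFDerivAt.comp_hasDerivAt (f := fun s' : ℝ => (s', t)) s hd
    ((hasDerivAt_id s).prodMk (hasDerivAt_const s t))).clm_apply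
    (hasDerivAt_const s ((0, 1) : ℝ × ℝ))
  refine ((dT_congr hJ (fun s hs t ht => (hf.hasDerivAt_fst hI hJ hs ht).deriv) hs ht).trans
    h₁.deriv).trans (Eq.trans ?_
      ((dS_congr hI (fun s hs t ht => (hf.hasDerivAt_snd hI hJ hs ht).deriv) hs ht).trans
        h₂.deriv).symm)
  simpa using hsymm.eq (0, 1) (1, 0)

end SmoothOn

theorem _root_.ContDiffOn.smoothOn_fst {h : ℝ → F} (hh : ContDiffOn ℝ ∞ h I) :
    SmoothOn (fun s _ => h s) I J :=
  ContDiffOn.comp hh contDiffOn_fst fun _ hp => hp.1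

end Calculus

/-! ### The vector product and orthonormal frames -/

theorem inner_eq_sum (a b : E3) : (inner ℝ a b : ℝ) = a 0 * b 0 + a 1 * b 1 + a 2 * b 2 := by
  simp [PiLp.inner_apply, Fin.sum_univ_three, mul_comm]

theorem cross_apply_zero (a b : E3) : cross a b 0 = a 1 * b 2 - a 2 * b 1 := by
  simp [cross, crossProduct]

theorem cross_apply_one (a b : E3) : cross a b 1 = a 2 * b 0 - a 0 * b 2 := by
  simp [cross, crossProduct]

theorem cross_apply_two (a b : E3) : cross a b 2 = a 0 * b 1 - a 1 * b 0 := by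
  simp [cross, crossProduct]

theorem inner_cross_left (a b : E3) : (inner ℝ a (cross a b) : ℝ) = 0 := by
  simp only [inner_eq_sum, cross_apply_zero, cross_apply_one, cross_apply_two]; ring

theorem inner_cross_right (a b : E3) : (inner ℝ b (cross a b) : ℝ) = 0 := by
  simp only [inner_eq_sum, cross_apply_zero, cross_apply_one, cross_apply_two]; ring

/-- Lagrange's identity. -/
theorem inner_cross_self (a b : E3) :
    (inner ℝ (cross a b) (cross a b) : ℝ) =
      inner ℝ a a * inner ℝ b b - inner ℝ a b ^ 2 := by
  simp only [inner_eq_sum, cross_apply_zero, cross_apply_one, cross_apply_two]; ring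

theorem cross_cross (d a b : E3) :
    cross d (cross a b) = (inner ℝ d b : ℝ) • a - (inner ℝ d a : ℝ) • b := by
  ext i
  fin_cases i <;>
  · simp [inner_eq_sum, cross_apply_zero, cross_apply_one, cross_apply_two]
    ring

/-- A vector orthogonal to `a`, `b` and `a × b ≠ 0` vanishes: by the triple product expansion its
vector product with `a × b` is zero, so Lagrange's identity gives `‖d‖² ‖a × b‖² = 0`. -/
theorem eq_zero_of_inner_cross_eq_zero {a b d : E3} (hc : cross a b ≠ 0)
    (ha : (inner ℝ d a : ℝ) = 0) (hb : (inner ℝ d b : ℝ) = 0)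
    (hab : (inner ℝ d (cross a b) : ℝ) = 0) : d = 0 := by
  have h := inner_cross_self d (cross a b)
  rw [cross_cross, ha, hb, hab] at h
  have h' : (inner ℝ d d : ℝ) * inner ℝ (cross a b) (cross a b) = 0 := by
    simpa using h.symm
  rcases mul_eq_zero.mp h' with h | h
  · exact inner_self_eq_zero.mp h
  · exact absurd (inner_self_eq_zero.mp h) hc

theorem _root_.ContDiffOn.cross {I : Set ℝ} {f g : ℝ → E3} (hf : ContDiffOn ℝ ∞ f I)
    (hg : ContDiffOn ℝ ∞ g I) : ContDiffOn ℝ ∞ (fun s => cross (f s) (g s)) I := by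
  rw [contDiffOn_euclidean] at hf hg ⊢
  intro i
  fin_cases i
  · simpa [cross_apply_zero] using ((hf 1).mul (hg 2)).sub ((hf 2).mul (hg 1))
  · simpa [cross_apply_one] using ((hf 2).mul (hg 0)).sub ((hf 0).mul (hg 2))
  · simpa [cross_apply_two] using ((hf 0).mul (hg 1)).sub ((hf 1).mul (hg 0))

/-! ### The Frenet frame -/

namespace IsFrenetCurve

variable {r : ℝ → E3} {I : Set ℝ} {s : ℝ}

theorem contDiffOn_T (hr : IsFrenetCurve r I) (hI : IsOpen I) : ContDiffOn ℝ ∞ (T r) I :=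
  hr.smooth.deriv_of_isOpen hI (by simp)

theorem contDiffOn_deriv_T (hr : IsFrenetCurve r I) (hI : IsOpen I) :
    ContDiffOn ℝ ∞ (deriv (T r)) I :=
  (hr.contDiffOn_T hI).deriv_of_isOpen hI (by simp)

theorem contDiffOn_κ (hr : IsFrenetCurve r I) (hI : IsOpen I) : ContDiffOn ℝ ∞ (κ r) I :=
  (hr.contDiffOn_deriv_T hI).norm ℝ hr.second_ne_zero

theorem κ_ne_zero (hr : IsFrenetCurve r I) (hs : s ∈ I) : κ r s ≠ 0 :=
  norm_ne_zero_iff.mpr (hr.second_ne_zero s hs)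

theorem contDiffOn_N (hr : IsFrenetCurve r I) (hI : IsOpen I) : ContDiffOn ℝ ∞ (N r) I :=
  ((hr.contDiffOn_κ hI).inv fun _ hs => hr.κ_ne_zero hs).smul (hr.contDiffOn_deriv_T hI)

theorem contDiffOn_B (hr : IsFrenetCurve r I) (hI : IsOpen I) : ContDiffOn ℝ ∞ (B r) I :=
  (hr.contDiffOn_T hI).cross (hr.contDiffOn_N hI)

theorem contDiffOn_τ (hr : IsFrenetCurve r I) (hI : IsOpen I) : ContDiffOn ℝ ∞ (τ r) I :=
  ((hr.contDiffOn_N hI).deriv_of_isOpen hI (by simp)).inner ℝ (hr.contDiffOn_B hI)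

end IsFrenetCurve

theorem hasDerivAt_of_contDiffOn {F : Type*} [NormedAddCommGroup F] [NormedSpace ℝ F]
    {f : ℝ → F} {I : Set ℝ} {s : ℝ} (hf : ContDiffOn ℝ ∞ f I) (hI : IsOpen I) (hs : s ∈ I) :
    HasDerivAt f (deriv f s) s :=
  ((hf.contDiffAt (hI.mem_nhds hs)).differentiableAt (by simp)).hasDerivAt

/-- Differentiating a constant inner product. -/
theorem inner_deriv_add_eq_zero {f g : ℝ → E3} {I : Set ℝ} {s c : ℝ} (hf : ContDiffOn ℝ ∞ f I)
    (hg : ContDiffOn ℝ ∞ g I) (hI : IsOpen I) (hs : s ∈ I)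
    (h : ∀ s ∈ I, (inner ℝ (f s) (g s) : ℝ) = c) :
    (inner ℝ (f s) (deriv g s) : ℝ) + inner ℝ (deriv f s) (g s) = 0 := by
  have h₁ := (hasDerivAt_of_contDiffOn hf hI hs).inner ℝ (hasDerivAt_of_contDiffOn hg hI hs)
  have h₂ : HasDerivAt (fun s => (inner ℝ (f s) (g s) : ℝ)) 0 s :=
    (hasDerivAt_const s c).congr_of_eventuallyEq
      (by filter_upwards [hI.mem_nhds hs] with s' hs' using h s' hs')
  exact h₁.unique h₂

/-- The vector with coordinates `(a, b, c)` in the Frenet frame of `r` at `s`. -/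
noncomputable def frameVec (r : ℝ → E3) (s a b c : ℝ) : E3 := a • T r s + b • N r s + c • B r s

namespace IsFrenetCurve

variable {r : ℝ → E3} {I : Set ℝ} {s : ℝ}

theorem inner_T_T (hr : IsFrenetCurve r I) (hs : s ∈ I) :
    (inner ℝ (T r s) (T r s) : ℝ) = 1 := by
  rw [real_inner_self_eq_norm_sq, T, hr.unit_speed s hs, one_pow]

theorem inner_N_N (hr : IsFrenetCurve r I) (hs : s ∈ I) :
    (inner ℝ (N r s) (N r s) : ℝ) = 1 := by
  have : ‖deriv (T r) s‖ ≠ 0 := hr.κ_ne_zero hs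
  rw [real_inner_self_eq_norm_sq, N, norm_smul, norm_inv, norm_norm, inv_mul_cancel₀ this,
    one_pow]

theorem deriv_T (hr : IsFrenetCurve r I) (hs : s ∈ I) : deriv (T r) s = κ r s • N r s :=
  (smul_inv_smul₀ (hr.κ_ne_zero hs) _).symm

theorem inner_T_N (hr : IsFrenetCurve r I) (hI : IsOpen I) (hs : s ∈ I) :
    (inner ℝ (T r s) (N r s) : ℝ) = 0 := by
  have h := inner_deriv_add_eq_zero (hr.contDiffOn_T hI) (hr.contDiffOn_T hI) hI hs
    fun _ => hr.inner_T_T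
  rw [real_inner_comm (T r s) (deriv (T r) s), ← two_mul, hr.deriv_T hs, inner_smul_right] at h
  simpa [hr.κ_ne_zero hs] using h

theorem inner_T_B (r : ℝ → E3) (s : ℝ) : (inner ℝ (T r s) (B r s) : ℝ) = 0 :=
  inner_cross_left _ _

theorem inner_N_B (r : ℝ → E3) (s : ℝ) : (inner ℝ (N r s) (B r s) : ℝ) = 0 :=
  inner_cross_right _ _

theorem inner_B_B (hr : IsFrenetCurve r I) (hI : IsOpen I) (hs : s ∈ I) :
    (inner ℝ (B r s) (B r s) : ℝ) = 1 := by
  rw [B, inner_cross_self, hr.inner_T_T hs, hr.inner_N_N hs, hr.inner_T_N hI hs]; norm_num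

theorem inner_frameVec (hr : IsFrenetCurve r I) (hI : IsOpen I) (hs : s ∈ I)
    (a b c a' b' c' : ℝ) :
    (inner ℝ (frameVec r s a b c) (frameVec r s a' b' c') : ℝ) =
      a * a' + b * b' + c * c' := by
  have h₁ := hr.inner_T_N hI hs
  have h₂ := inner_T_B r s
  have h₃ := inner_N_B r s
  have h₁' := (real_inner_comm _ _).trans h₁
  have h₂' := (real_inner_comm _ _).trans h₂
  have h₃' := (real_inner_comm _ _).trans h₃
  simp only [frameVec, inner_add_left, inner_add_right, real_inner_smul_left,
    real_inner_smul_right, h₁, h₂, h₃, h₁', h₂', h₃', hr.inner_T_T hs, hr.inner_N_N hs,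
    hr.inner_B_B hI hs]
  ring

theorem frameVec_eq_zero_iff (hr : IsFrenetCurve r I) (hI : IsOpen I) (hs : s ∈ I)
    {a b c : ℝ} : frameVec r s a b c = 0 ↔ a = 0 ∧ b = 0 ∧ c = 0 := by
  rw [← inner_self_eq_zero (𝕜 := ℝ), hr.inner_frameVec hI hs]
  constructor
  · intro h
    refine ⟨?_, ?_, ?_⟩ <;> nlinarith [mul_self_nonneg a, mul_self_nonneg b, mul_self_nonneg c]
  · rintro ⟨rfl, rfl, rfl⟩; simp

/-- Three orthonormal vectors span Euclidean three-space, so every vector is recovered from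
its components along the Frenet frame. -/
theorem eq_frameVec (hr : IsFrenetCurve r I) (hI : IsOpen I) (hs : s ∈ I) (y : E3) :
    y = frameVec r s (inner ℝ y (T r s)) (inner ℝ y (N r s)) (inner ℝ y (B r s)) := by
  have hB : cross (T r s) (N r s) ≠ 0 := by
    intro h
    have h' := hr.inner_B_B hI hs
    simp [B, h] at h'
  have hT : ∀ a b c, (inner ℝ (frameVec r s a b c) (T r s) : ℝ) = a := fun a b c => by
    simpa [frameVec] using hr.inner_frameVec hI hs a b c 1 0 0
  have hN : ∀ a b c, (inner ℝ (frameVec r s a b c) (N r s) : ℝ) = b := fun a b c => by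
    simpa [frameVec] using hr.inner_frameVec hI hs a b c 0 1 0
  have hB' : ∀ a b c, (inner ℝ (frameVec r s a b c) (B r s) : ℝ) = c := fun a b c => by
    simpa [frameVec] using hr.inner_frameVec hI hs a b c 0 0 1
  refine sub_eq_zero.mp (eq_zero_of_inner_cross_eq_zero hB ?_ ?_ ?_)
  · rw [inner_sub_left, hT, sub_self]
  · rw [inner_sub_left, hN, sub_self]
  · change (inner ℝ _ (B r s) : ℝ) = 0
    rw [inner_sub_left, hB', sub_self]

theorem deriv_N (hr : IsFrenetCurve r I) (hI : IsOpen I) (hs : s ∈ I) :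
    deriv (N r) s = -κ r s • T r s + τ r s • B r s := by
  have hNN := inner_deriv_add_eq_zero (hr.contDiffOn_N hI) (hr.contDiffOn_N hI) hI hs
    fun _ => hr.inner_N_N
  have hTN := inner_deriv_add_eq_zero (hr.contDiffOn_T hI) (hr.contDiffOn_N hI) hI hs
    fun _ => hr.inner_T_N hI
  rw [hr.deriv_T hs, real_inner_smul_left, hr.inner_N_N hs] at hTN
  rw [real_inner_comm] at hNN hTN
  have h₁ : (inner ℝ (deriv (N r) s) (T r s) : ℝ) = -κ r s := by linarith
  have h₂ : (inner ℝ (deriv (N r) s) (N r s) : ℝ) = 0 := by linarith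
  have h := hr.eq_frameVec hI hs (deriv (N r) s)
  rw [h₁, h₂] at h
  simpa [frameVec, τ] using h

theorem deriv_B (hr : IsFrenetCurve r I) (hI : IsOpen I) (hs : s ∈ I) :
    deriv (B r) s = -τ r s • N r s := by
  have hBB := inner_deriv_add_eq_zero (hr.contDiffOn_B hI) (hr.contDiffOn_B hI) hI hs
    fun _ => hr.inner_B_B hI
  have hTB := inner_deriv_add_eq_zero (hr.contDiffOn_T hI) (hr.contDiffOn_B hI) hI hs
    fun s _ => inner_T_B r s
  have hNB := inner_deriv_add_eq_zero (hr.contDiffOn_N hI) (hr.contDiffOn_B hI) hI hs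
    fun s _ => inner_N_B r s
  rw [hr.deriv_T hs, real_inner_smul_left, inner_N_B] at hTB
  change _ + τ r s = 0 at hNB
  rw [real_inner_comm] at hBB hTB hNB
  have h₁ : (inner ℝ (deriv (B r) s) (T r s) : ℝ) = 0 := by linarith
  have h₂ : (inner ℝ (deriv (B r) s) (N r s) : ℝ) = -τ r s := by linarith
  have h₃ : (inner ℝ (deriv (B r) s) (B r s) : ℝ) = 0 := by linarith
  have h := hr.eq_frameVec hI hs (deriv (B r) s)
  rw [h₁, h₂, h₃] at h
  simpa [frameVec] using h

/-- The Frenet equations in coordinates. -/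
theorem hasDerivAt_frameVec (hr : IsFrenetCurve r I) (hI : IsOpen I) (hs : s ∈ I)
    {a b c : ℝ → ℝ} {a' b' c' : ℝ} (ha : HasDerivAt a a' s) (hb : HasDerivAt b b' s)
    (hc : HasDerivAt c c' s) :
    HasDerivAt (fun s => frameVec r s (a s) (b s) (c s))
      (frameVec r s (a' - κ r s * b s) (b' + κ r s * a s - τ r s * c s)
        (c' + τ r s * b s)) s := by
  have hT := hasDerivAt_of_contDiffOn (hr.contDiffOn_T hI) hI hs
  have hN := hasDerivAt_of_contDiffOn (hr.contDiffOn_N hI) hI hs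
  have hB := hasDerivAt_of_contDiffOn (hr.contDiffOn_B hI) hI hs
  rw [hr.deriv_T hs] at hT
  rw [hr.deriv_N hI hs] at hN
  rw [hr.deriv_B hI hs] at hB
  refine (((ha.smul hT).add (hb.smul hN)).add (hc.smul hB)).congr_deriv ?_
  simp only [frameVec]
  module

end IsFrenetCurve

theorem hasDerivAt_frameVec_const (r : ℝ → E3) (s : ℝ) {t : ℝ} {a b c : ℝ → ℝ} {a' b' c' : ℝ}
    (ha : HasDerivAt a a' t) (hb : HasDerivAt b b' t) (hc : HasDerivAt c c' t) :
    HasDerivAt (fun t => frameVec r s (a t) (b t) (c t)) (frameVec r s a' b' c') t :=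
  ((ha.smul_const _).add (hb.smul_const _)).add (hc.smul_const _)

/-! ### Minimal surfaces in isothermal parameters are harmonic -/

section Harmonic

variable {x : ℝ → ℝ → E3} {I J : Set ℝ} {s t : ℝ}

/-- From `E_s = G_s` and `F_t = 0`. -/
theorem IsIsothermal.inner_laplacian_dS (hE : IsIsothermal x I J) (hx : SmoothOn x I J)
    (hI : IsOpen I) (hJ : IsOpen J) (hs : s ∈ I) (ht : t ∈ J) :
    (inner ℝ (dS (dS x) s t + dT (dT x) s t) (dS x s t) : ℝ) = 0 := by
  have hxs := hx.dS hI hJ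
  have hxt := hx.dT hI hJ
  have h₁ := (hxs.hasDerivAt_dS hI hJ hs ht).inner ℝ (hxs.hasDerivAt_dS hI hJ hs ht)
  have h₂ := (hxt.hasDerivAt_dS hI hJ hs ht).inner ℝ (hxt.hasDerivAt_dS hI hJ hs ht)
  have h₃ := (hxs.hasDerivAt_dT hI hJ hs ht).inner ℝ (hxt.hasDerivAt_dT hI hJ hs ht)
  have hEG := h₁.unique (h₂.congr_of_eventuallyEq
    (by filter_upwards [hI.mem_nhds hs] with s' hs' using (hE s' hs' t ht).1))
  have hF := h₃.unique ((hasDerivAt_const t (0 : ℝ)).congr_of_eventuallyEq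
    (by filter_upwards [hJ.mem_nhds ht] with t' ht' using (hE s hs t' ht').2))
  rw [hx.dT_dS_eq_dS_dT hI hJ hs ht] at hF
  rw [inner_add_left]
  have c₁ := real_inner_comm (dS x s t) (dS (dS x) s t)
  have c₂ := real_inner_comm (dT x s t) (dS (dT x) s t)
  have c₃ := real_inner_comm (dS x s t) (dT (dT x) s t)
  linarith

/-- From `E_t = G_t` and `F_s = 0`. -/
theorem IsIsothermal.inner_laplacian_dT (hE : IsIsothermal x I J) (hx : SmoothOn x I J)
    (hI : IsOpen I) (hJ : IsOpen J) (hs : s ∈ I) (ht : t ∈ J) :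
    (inner ℝ (dS (dS x) s t + dT (dT x) s t) (dT x s t) : ℝ) = 0 := by
  have hxs := hx.dS hI hJ
  have hxt := hx.dT hI hJ
  have h₁ := (hxs.hasDerivAt_dT hI hJ hs ht).inner ℝ (hxs.hasDerivAt_dT hI hJ hs ht)
  have h₂ := (hxt.hasDerivAt_dT hI hJ hs ht).inner ℝ (hxt.hasDerivAt_dT hI hJ hs ht)
  have h₃ := (hxs.hasDerivAt_dS hI hJ hs ht).inner ℝ (hxt.hasDerivAt_dS hI hJ hs ht)
  have hEG := h₁.unique (h₂.congr_of_eventuallyEq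
    (by filter_upwards [hJ.mem_nhds ht] with t' ht' using (hE s hs t' ht').1))
  have hF := h₃.unique ((hasDerivAt_const s (0 : ℝ)).congr_of_eventuallyEq
    (by filter_upwards [hI.mem_nhds hs] with s' hs' using (hE s' hs' t ht).2))
  rw [hx.dT_dS_eq_dS_dT hI hJ hs ht] at hEG
  rw [inner_add_left]
  have c₁ := real_inner_comm (dS x s t) (dS (dT x) s t)
  have c₂ := real_inner_comm (dT x s t) (dT (dT x) s t)
  linarith

theorem IsRegularSurface.inner_dS_self_ne_zero (hx : IsRegularSurface x I J)
    (hs : s ∈ I) (ht : t ∈ J) : (inner ℝ (dS x s t) (dS x s t) : ℝ) ≠ 0 := by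
  intro h
  exact (hx.regular s hs t ht).ne_zero 0 (inner_self_eq_zero.mp h)

theorem IsIsothermal.cross_ne_zero (hE : IsIsothermal x I J) (hx : IsRegularSurface x I J)
    (hs : s ∈ I) (ht : t ∈ J) : cross (dS x s t) (dT x s t) ≠ 0 := by
  intro h
  have h' := inner_cross_self (dS x s t) (dT x s t)
  rw [h, ← (hE s hs t ht).1, (hE s hs t ht).2] at h'
  have h₀ := hx.inner_dS_self_ne_zero hs ht
  simp at h'
  simp [h'] at h₀

/-- In isothermal parameters the mean curvature is `⟨n, Δx⟩ / (2E)`. -/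
theorem IsIsothermal.meanCurvature_eq (hE : IsIsothermal x I J) (hx : IsRegularSurface x I J)
    (hs : s ∈ I) (ht : t ∈ J) :
    meanCurvature x s t =
      inner ℝ (normal x s t) (dS (dS x) s t + dT (dT x) s t) / (2 * fundE x s t) := by
  have h₀ : fundE x s t ≠ 0 := hx.inner_dS_self_ne_zero hs ht
  have h₁ : fundG x s t = fundE x s t := (hE s hs t ht).1.symm
  have h₂ : fundF x s t = 0 := (hE s hs t ht).2
  rw [meanCurvature, h₁, h₂, inner_add_right, ← funde, ← fundg]
  field_simp
  ring

/-- The classical equivalence between minimality and harmonicity of the position vector.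
The Laplacian `Δx` of an isothermal parametrization is always normal to the surface, by
differentiating `E = G` and `F = 0`, so only its normal component, which is `2EH`, matters. -/
theorem IsIsothermal.isMinimalSurface_iff (hE : IsIsothermal x I J)
    (hx : IsRegularSurface x I J) (hI : IsOpen I) (hJ : IsOpen J) :
    IsMinimalSurface x I J ↔ ∀ s ∈ I, ∀ t ∈ J, dS (dS x) s t + dT (dT x) s t = 0 := by
  constructor
  · rintro ⟨-, hH⟩ s hs t ht
    have hc := hE.cross_ne_zero hx hs ht
    have h := hH s hs t ht
    have h₀ : fundE x s t ≠ 0 := hx.inner_dS_self_ne_zero hs ht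
    rw [hE.meanCurvature_eq hx hs ht, normal, real_inner_smul_left] at h
    refine eq_zero_of_inner_cross_eq_zero hc
      (hE.inner_laplacian_dS hx.smooth hI hJ hs ht)
      (hE.inner_laplacian_dT hx.smooth hI hJ hs ht) ?_
    rw [real_inner_comm]
    simpa [h₀, hc] using h
  · refine fun h => ⟨hx, fun s hs t ht => ?_⟩
    rw [hE.meanCurvature_eq hx hs ht, h s hs t ht, inner_zero_right, zero_div]

end Harmonic

/-! ### The equations in the Frenet frame -/

section FrenetForm

variable {r : ℝ → E3} {x : ℝ → ℝ → E3} {u v w : ℝ → ℝ → ℝ} {I J : Set ℝ}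

theorem HasFrenetForm.dS_eq (h : HasFrenetForm x r u v w I J) (hr : IsFrenetCurve r I)
    (hu : SmoothOn u I J) (hv : SmoothOn v I J) (hw : SmoothOn w I J) (hI : IsOpen I)
    (hJ : IsOpen J) : ∀ s ∈ I, ∀ t ∈ J,
      dS x s t = frameVec r s (1 + dS u s t - κ r s * v s t)
        (dS v s t + κ r s * u s t - τ r s * w s t) (dS w s t + τ r s * v s t) := by
  intro s hs t ht
  have h₁ := (hasDerivAt_of_contDiffOn hr.smooth hI hs).add
    (hr.hasDerivAt_frameVec hI hs (hu.hasDerivAt_dS hI hJ hs ht)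
      (hv.hasDerivAt_dS hI hJ hs ht) (hw.hasDerivAt_dS hI hJ hs ht))
  rw [dS_congr hI h hs ht]
  refine (HasDerivAt.deriv (h₁.congr_of_eventuallyEq
    (Filter.Eventually.of_forall fun s' => ?_))).trans ?_
  · simp only [frameVec, Pi.add_apply]; module
  · change T r s + _ = _
    simp only [frameVec]; module

theorem HasFrenetForm.dT_eq (h : HasFrenetForm x r u v w I J)
    (hu : SmoothOn u I J) (hv : SmoothOn v I J) (hw : SmoothOn w I J) (hI : IsOpen I)
    (hJ : IsOpen J) : ∀ s ∈ I, ∀ t ∈ J,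
      dT x s t = frameVec r s (dT u s t) (dT v s t) (dT w s t) := by
  intro s hs t ht
  have h₁ := (hasDerivAt_frameVec_const r s (hu.hasDerivAt_dT hI hJ hs ht)
      (hv.hasDerivAt_dT hI hJ hs ht) (hw.hasDerivAt_dT hI hJ hs ht)).const_add (r s)
  rw [dT_congr hJ h hs ht]
  refine HasDerivAt.deriv (h₁.congr_of_eventuallyEq
    (Filter.Eventually.of_forall fun t' => ?_))
  simp only [frameVec]; module

theorem HasFrenetForm.laplacian_eq (h : HasFrenetForm x r u v w I J) (hr : IsFrenetCurve r I)
    (hu : SmoothOn u I J) (hv : SmoothOn v I J) (hw : SmoothOn w I J) (hI : IsOpen I)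
    (hJ : IsOpen J) : ∀ s ∈ I, ∀ t ∈ J,
      dS (dS x) s t + dT (dT x) s t = frameVec r s
        (dS (fun s t => 1 + dS u s t - κ r s * v s t) s t
          - κ r s * (dS v s t + κ r s * u s t - τ r s * w s t) + dT (dT u) s t)
        (dS (fun s t => dS v s t + κ r s * u s t - τ r s * w s t) s t
          + κ r s * (1 + dS u s t - κ r s * v s t) - τ r s * (dS w s t + τ r s * v s t)
          + dT (dT v) s t)
        (dS (fun s t => dS w s t + τ r s * v s t) s t
          + τ r s * (dS v s t + κ r s * u s t - τ r s * w s t) + dT (dT w) s t) := by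
  intro s hs t ht
  have hκ : SmoothOn (fun s _ => κ r s) I J := (hr.contDiffOn_κ hI).smoothOn_fst
  have hτ : SmoothOn (fun s _ => τ r s) I J := (hr.contDiffOn_τ hI).smoothOn_fst
  have ha : SmoothOn (fun s t => 1 + dS u s t - κ r s * v s t) I J :=
    ContDiffOn.sub (contDiffOn_const.add (hu.dS hI hJ)) (hκ.mul hv)
  have hb : SmoothOn (fun s t => dS v s t + κ r s * u s t - τ r s * w s t) I J :=
    ContDiffOn.sub (ContDiffOn.add (hv.dS hI hJ) (hκ.mul hu)) (hτ.mul hw)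
  have hc : SmoothOn (fun s t => dS w s t + τ r s * v s t) I J :=
    ContDiffOn.add (hw.dS hI hJ) (hτ.mul hv)
  have h₁ := (hr.hasDerivAt_frameVec hI hs (ha.hasDerivAt_dS hI hJ hs ht)
    (hb.hasDerivAt_dS hI hJ hs ht) (hc.hasDerivAt_dS hI hJ hs ht)).deriv
  have h₂ := (hasDerivAt_frameVec_const r s ((hu.dT hI hJ).hasDerivAt_dT hI hJ hs ht)
    ((hv.dT hI hJ).hasDerivAt_dT hI hJ hs ht) ((hw.dT hI hJ).hasDerivAt_dT hI hJ hs ht)).deriv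
  have e₁ := (dS_congr hI (h.dS_eq hr hu hv hw hI hJ) hs ht).trans h₁
  have e₂ := (dT_congr hJ (h.dT_eq hu hv hw hI hJ) hs ht).trans h₂
  rw [e₁, e₂]
  simp only [frameVec]
  module

/-- Every smooth surface has Frenet coordinates, namely the components of `x - r` along the
frame. -/
theorem exists_hasFrenetForm (hx : SmoothOn x I J) (hr : IsFrenetCurve r I) (hI : IsOpen I) :
    ∃ u v w : ℝ → ℝ → ℝ, SmoothOn u I J ∧ SmoothOn v I J ∧ SmoothOn w I J ∧
      HasFrenetForm x r u v w I J := by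
  have hr' : SmoothOn (fun s _ => r s) I J := hr.smooth.smoothOn_fst
  have hT : SmoothOn (fun s _ => T r s) I J := (hr.contDiffOn_T hI).smoothOn_fst
  have hN : SmoothOn (fun s _ => N r s) I J := (hr.contDiffOn_N hI).smoothOn_fst
  have hB : SmoothOn (fun s _ => B r s) I J := (hr.contDiffOn_B hI).smoothOn_fst
  have hd : ContDiffOn ℝ ∞ (fun p : ℝ × ℝ => x p.1 p.2 - r p.1) (I ×ˢ J) := ContDiffOn.sub hx hr'
  refine ⟨fun s t => inner ℝ (x s t - r s) (T r s), fun s t => inner ℝ (x s t - r s) (N r s),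
    fun s t => inner ℝ (x s t - r s) (B r s), hd.inner ℝ hT, hd.inner ℝ hN, hd.inner ℝ hB,
    fun s hs t _ => ?_⟩
  have h := hr.eq_frameVec hI hs (x s t - r s)
  rw [sub_eq_iff_eq_add'] at h
  simpa only [frameVec, add_assoc] using h

theorem HasFrenetForm.passesCurve_iff (h : HasFrenetForm x r u v w I J)
    (hr : IsFrenetCurve r I) (hI : IsOpen I) {t₀ : ℝ} (ht₀ : t₀ ∈ J) :
    PassesCurve x r I t₀ ↔ ∀ s ∈ I, u s t₀ = 0 ∧ v s t₀ = 0 ∧ w s t₀ = 0 := by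
  refine forall₂_congr fun s hs => ?_
  rw [← hr.frameVec_eq_zero_iff hI hs, h s hs t₀ ht₀, frameVec, add_assoc, add_assoc,
    add_eq_left, add_assoc]

theorem HasFrenetForm.isothermal_harmonic_iff (h : HasFrenetForm x r u v w I J)
    (hr : IsFrenetCurve r I) (hu : SmoothOn u I J) (hv : SmoothOn v I J) (hw : SmoothOn w I J)
    (hI : IsOpen I) (hJ : IsOpen J) :
    (IsIsothermal x I J ∧ ∀ s ∈ I, ∀ t ∈ J, dS (dS x) s t + dT (dT x) s t = 0) ↔
      ∀ s ∈ I, ∀ t ∈ J,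
        (1 + dS u s t - κ r s * v s t) ^ 2
            + (dS v s t + κ r s * u s t - τ r s * w s t) ^ 2
            + (dS w s t + τ r s * v s t) ^ 2
          = dT u s t ^ 2 + dT v s t ^ 2 + dT w s t ^ 2 ∧
        (1 + dS u s t - κ r s * v s t) * dT u s t
            + (dS v s t + κ r s * u s t - τ r s * w s t) * dT v s t
            + (dS w s t + τ r s * v s t) * dT w s t = 0 ∧
        dS (fun s t => 1 + dS u s t - κ r s * v s t) s t
            - κ r s * (dS v s t + κ r s * u s t - τ r s * w s t)
            + dT (dT u) s t = 0 ∧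
        dS (fun s t => dS v s t + κ r s * u s t - τ r s * w s t) s t
            + κ r s * (1 + dS u s t - κ r s * v s t)
            - τ r s * (dS w s t + τ r s * v s t)
            + dT (dT v) s t = 0 ∧
        dS (fun s t => dS w s t + τ r s * v s t) s t
            + τ r s * (dS v s t + κ r s * u s t - τ r s * w s t)
            + dT (dT w) s t = 0 := by
  simp only [IsIsothermal, ← forall_and]
  refine forall₄_congr fun s hs t ht => ?_
  rw [h.laplacian_eq hr hu hv hw hI hJ s hs t ht, h.dS_eq hr hu hv hw hI hJ s hs t ht,
    h.dT_eq hu hv hw hI hJ s hs t ht, hr.frameVec_eq_zero_iff hI hs,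
    hr.inner_frameVec hI hs, hr.inner_frameVec hI hs, hr.inner_frameVec hI hs, and_assoc]
  simp only [pow_two]

end FrenetForm

end FrenetSurface

theorem theorem1 (I J : Set ℝ) (hIo : IsOpen I) (hI : I.OrdConnected)
    (hJo : IsOpen J) (hJ : J.OrdConnected) (t₀ : ℝ) (ht₀ : t₀ ∈ J)
    (r : ℝ → E3) (hr : IsFrenetCurve r I)
    (x : ℝ → ℝ → E3) (hx : IsRegularSurface x I J) :
    (IsIsothermal x I J ∧ IsMinimalSurface x I J ∧ PassesCurve x r I t₀) ↔
      ∃ u v w : ℝ → ℝ → ℝ,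
        SmoothOn u I J ∧ SmoothOn v I J ∧ SmoothOn w I J ∧
        HasFrenetForm x r u v w I J ∧
        (∀ s ∈ I, u s t₀ = 0 ∧ v s t₀ = 0 ∧ w s t₀ = 0) ∧
        ∀ s ∈ I, ∀ t ∈ J,
          (1 + dS u s t - κ r s * v s t) ^ 2
              + (dS v s t + κ r s * u s t - τ r s * w s t) ^ 2
              + (dS w s t + τ r s * v s t) ^ 2
            = dT u s t ^ 2 + dT v s t ^ 2 + dT w s t ^ 2 ∧
          (1 + dS u s t - κ r s * v s t) * dT u s t
              + (dS v s t + κ r s * u s t - τ r s * w s t) * dT v s t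
              + (dS w s t + τ r s * v s t) * dT w s t = 0 ∧
          dS (fun s t => 1 + dS u s t - κ r s * v s t) s t
              - κ r s * (dS v s t + κ r s * u s t - τ r s * w s t)
              + dT (dT u) s t = 0 ∧
          dS (fun s t => dS v s t + κ r s * u s t - τ r s * w s t) s t
              + κ r s * (1 + dS u s t - κ r s * v s t)
              - τ r s * (dS w s t + τ r s * v s t)
              + dT (dT v) s t = 0 ∧
          dS (fun s t => dS w s t + τ r s * v s t) s t
              + τ r s * (dS v s t + κ r s * u s t - τ r s * w s t)
              + dT (dT w) s t = 0 := by
  constructor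
  · rintro ⟨hE, hM, hP⟩
    obtain ⟨u, v, w, hu, hv, hw, h⟩ := exists_hasFrenetForm hx.smooth hr hIo
    exact ⟨u, v, w, hu, hv, hw, h, (h.passesCurve_iff hr hIo ht₀).mp hP,
      (h.isothermal_harmonic_iff hr hu hv hw hIo hJo).mp
        ⟨hE, (hE.isMinimalSurface_iff hx hIo hJo).mp hM⟩⟩
  · rintro ⟨u, v, w, hu, hv, hw, h, h₀, heq⟩
    obtain ⟨hE, hL⟩ := (h.isothermal_harmonic_iff hr hu hv hw hIo hJo).mpr heq
    exact ⟨hE, (hE.isMinimalSurface_iff hx hIo hJo).mpr hL,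
      (h.passesCurve_iff hr hIo ht₀).mpr h₀⟩
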